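/- **Setting.** Let $X$ and $Y$ be finite-dimensional Euclidean spaces, $A:X\to Y$ a linear map with adjoint $A^*$, $b\in Y$, and $K\subseteq Y$ a closed convex cone (with $0\in K$). Put $P=\{x\in X : b-Ax\in K\}$. For a set $S$ let $S^*=\{y : \langle x,y\rangle\ge 0\ \forall x\in S\}$, let $S^\perp$ be the orthogonal complement of its linear span, and let $\operatorname{ri}$ and $\operatorname{cl}$ denote relative interior and closure. $P$ is *well-behaved* if for every $c\in X$ for which $v=\sup\{\langle c,x\rangle : x\in P\}$ is finite there is $y\in K^*$ with $A^*y=c$ and $\langle b,y\rangle=v$. A *maximum slack* is a point $z\in\operatorname{ri}\{z : z=b-Ax \text{ for some } x\in X,\ z\in K\}$. *Slater's condition* says that $b-Ax\in\operatorname{ri}K$ for some $x\in X$. The cone $K$ is *polyhedral* if it is the solution set of finitely many homogeneous linear inequalities $\langle a_i,y\rangle\ge0$. A *face* of $K$ is a nonempty convex subset $E\subseteq K$ such that $x_1,x_2\in K$ and $\tfrac12(x_1+x_2)\in E$ imply $x_1,x_2\in E$; its conjugate face is $E^\triangle=K^*\cap E^\perp$. The cone $K$ is *nice* if $K^*+E^\perp$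 is closed for every face $E$ of $K$. A vector $u\in K^*$ is *strictly complementary* to $z\in K$ if $z\in\operatorname{ri}E$ and $u\in\operatorname{ri}E^\triangle$ for some face $E$ of $K$. For $z\in K$ let $$\operatorname{dir}(z,K)=\{y : z+\varepsilon y\in K\text{ for some }\varepsilon>0\},\qquad \operatorname{ldir}(z,K)=\operatorname{dir}(z,K)\cap-\operatorname{dir}(z,K),$$ $$\tan(z,K)=\operatorname{cl}\operatorname{dir}(z,K)\cap-\operatorname{cl}\operatorname{dir}(z,K).$$ Let $(A,b):X\times\mathbb R\to Y$, $(x,t)\mapsto Ax+tb$, and $\begin{pmatrix}A&b\\0&1\end{pmatrix}:X\times\mathbb R\to Y\times\mathbb R$, $(x,t)\mapsto(Ax+tb,t)$; let $\mathcal R$ and $\mathcal N$ denote range and null space. **Corollary.** 1. If $K$ is polyhedral, then $P$ is well-behaved. 2. Let $z$ be a maximum slack in $P$. Then $z\in\operatorname{ri}K$ if and only if Slater's condition holds, and in this case $P$ is well-behaved. 3. Let $K$ be nice and let $z$ be a maximum slack in $P$. Then the following are equivalent: 1. $P$ is well-behaved; 2. $\begin{pmatrix}A&b\\0&1\end{pmatrix}^{*}(K^*\times\mathbb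 R_+)$ is closed; 3. $(A,b)^*K^*$ is closed; 4. $\mathcal R(A,b)\cap\bigl(\operatorname{cl}\operatorname{dir}(z,K)\setminus\operatorname{dir}(z,K)\bigr)=\emptyset$; 5. there is $u\in\mathcal N((A,b)^*)\cap K^*$ strictly complementary to $z$, and $\mathcal R(A,b)\cap\bigl(\tan(z,K)\setminus\operatorname{ldir}(z,K)\bigr)=\emptyset$. -/

import Mathlib

open scoped RealInnerProductSpace Pointwise

noncomputable section

namespace ConicSystem

variable {X Y : Type*}
  [NormedAddCommGroup X] [InnerProductSpace ℝ X] [FiniteDimensional ℝ X]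
  [NormedAddCommGroup Y] [InnerProductSpace ℝ Y] [FiniteDimensional ℝ Y]

/-! ### Convex geometry

A closed convex cone (containing `0`) is a Mathlib `ProperCone ℝ Y`; despite its name this type
requires neither pointedness nor nonempty interior. The relative interior `ri S` is
`intrinsicInterior ℝ S`, and faces are Mathlib's `PointedCone.IsFaceOf`. -/

/-- The dual cone `S* = {y | ⟪x, y⟫ ≥ 0 for all x ∈ S}`. -/
def dualCone (S : Set Y) : Set Y := {y | ∀ x ∈ S, 0 ≤ ⟪x, y⟫}

/-- The orthogonal complement of the linear span of `S`. -/
def perp (S : Set Y) : Submodule ℝ Y := (Submodule.span ℝ S)ᗮ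

/-- The feasible directions at `x` in `C`. -/
def dir (x : Y) (C : Set Y) : Set Y := {y | ∃ ε : ℝ, 0 < ε ∧ x + ε • y ∈ C}

/-- The lineality space of `dir x C`. -/
def ldir (x : Y) (C : Set Y) : Set Y := dir x C ∩ -dir x C

/-- The tangent space at `x` in `C`. -/
def tanSpace (x : Y) (C : Set Y) : Set Y := closure (dir x C) ∩ -closure (dir x C)

/-- The conjugate face `E^△ = C* ∩ E^⊥` of a face `E` of the cone `C`. -/
def conjugateFace (C : ProperCone ℝ Y) (E : PointedCone ℝ Y) : Set Y :=
  dualCone (C : Set Y) ∩ (perp (E : Set Y) : Set Y)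

/-- `u` is strictly complementary to `x` (with respect to `C`): `x` lies in the relative interior
of a face `E` of `C`, and `u` lies in the relative interior of the conjugate face of `E`. -/
def StrictlyComplementary (C : ProperCone ℝ Y) (u x : Y) : Prop :=
  ∃ E : PointedCone ℝ Y, E.IsFaceOf C.toPointedCone ∧
    x ∈ intrinsicInterior ℝ (E : Set Y) ∧ u ∈ intrinsicInterior ℝ (conjugateFace C E)

/-- `C` is nice: `C* + E^⊥` is closed for every face `E` of `C`. -/
def IsNice (C : ProperCone ℝ Y) : Prop :=
  ∀ E : PointedCone ℝ Y, E.IsFaceOf C.toPointedCone →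
    IsClosed (dualCone (C : Set Y) + (perp (E : Set Y) : Set Y))

/-- `C` is polyhedral: it is the solution set of finitely many homogeneous linear
inequalities `0 ≤ ⟪a, y⟫`. -/
def IsPolyhedral (C : ProperCone ℝ Y) : Prop :=
  ∃ s : Finset Y, (C : Set Y) = {y | ∀ a ∈ s, 0 ≤ ⟪a, y⟫}

/-! ### The conic system `P = {x | Ax ≤_K b}` -/

/-- The feasible set `P = {x | b - A x ∈ K}`. -/
def feasibleSet (K : ProperCone ℝ Y) (A : X →ₗ[ℝ] Y) (b : Y) : Set X := {x | b - A x ∈ K}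

/-- `P` is well-behaved: for every `c` for which `sup {⟪c, x⟫ | x ∈ P}` is a finite real number
`v`, the dual problem `inf {⟪b, y⟫ | y ∈ K*, A* y = c}` has a feasible solution with value `v`.
(For empty `P` the set of values has no least upper bound in `ℝ`: the supremum is `-∞`.) -/
def WellBehaved (K : ProperCone ℝ Y) (A : X →ₗ[ℝ] Y) (b : Y) : Prop :=
  ∀ (c : X) (v : ℝ), IsLUB ((fun x => ⟪c, x⟫) '' feasibleSet K A b) v →
    ∃ y ∈ dualCone (K : Set Y), LinearMap.adjoint A y = c ∧ ⟪b, y⟫ = v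

/-- The set of slacks `{z | z = b - A x for some x, z ∈ K}`. -/
def slackSet (K : ProperCone ℝ Y) (A : X →ₗ[ℝ] Y) (b : Y) : Set Y :=
  {z | (∃ x, z = b - A x) ∧ z ∈ K}

/-- A maximum slack is a point in the relative interior of the set of slacks. -/
def IsMaximumSlack (K : ProperCone ℝ Y) (A : X →ₗ[ℝ] Y) (b z : Y) : Prop :=
  z ∈ intrinsicInterior ℝ (slackSet K A b)

/-- Slater's condition: some slack lies in the relative interior of `K`. -/
def SlaterCondition (K : ProperCone ℝ Y) (A : X →ₗ[ℝ] Y) (b : Y) : Prop :=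
  ∃ x, b - A x ∈ intrinsicInterior ℝ (K : Set Y)

/-- The operator `(A, b) : X × ℝ → Y`, `(x, t) ↦ A x + t b`. The product `WithLp 2 (X × ℝ)` has
the Euclidean inner product. -/
def opAb (A : X →ₗ[ℝ] Y) (b : Y) : WithLp 2 (X × ℝ) →ₗ[ℝ] Y where
  toFun p := A p.fst + p.snd • b
  map_add' p q := by simp [add_smul]; abel
  map_smul' r p := by simp [mul_smul]

/-- The block operator `(A, b; 0, 1) : X × ℝ → Y × ℝ`, `(x, t) ↦ (A x + t b, t)`. -/
def opAb01 (A : X →ₗ[ℝ] Y) (b : Y) : WithLp 2 (X × ℝ) →ₗ[ℝ] WithLp 2 (Y × ℝ) where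
  toFun p := WithLp.toLp 2 (A p.fst + p.snd • b, p.snd)
  map_add' p q := by
    apply WithLp.ofLp_injective
    ext
    · simp [add_smul]; abel
    · simp
  map_smul' r p := by
    apply WithLp.ofLp_injective
    ext <;> simp [mul_smul]

/-- The image of `K* × ℝ₊` under the adjoint of `(A, b; 0, 1)` is closed. -/
def ClosedImageExtended (K : ProperCone ℝ Y) (A : X →ₗ[ℝ] Y) (b : Y) : Prop :=
  IsClosed (LinearMap.adjoint (opAb01 A b) ''
    {p : WithLp 2 (Y × ℝ) | p.fst ∈ dualCone (K : Set Y) ∧ 0 ≤ p.snd})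

/-- The image of `K*` under the adjoint of `(A, b)` is closed. -/
def ClosedImage (K : ProperCone ℝ Y) (A : X →ₗ[ℝ] Y) (b : Y) : Prop :=
  IsClosed (LinearMap.adjoint (opAb A b) '' dualCone (K : Set Y))

/-- The range of `(A, b)` does not meet `cl dir(z, K) \ dir(z, K)`. -/
def NoFrontierDirection (K : ProperCone ℝ Y) (A : X →ₗ[ℝ] Y) (b z : Y) : Prop :=
  (LinearMap.range (opAb A b) : Set Y) ∩
    (closure (dir z (K : Set Y)) \ dir z (K : Set Y)) = ∅

/-- Some `u ∈ 𝒩((A, b)*) ∩ K*` is strictly complementary to `z`, and the range of `(A, b)` does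
not meet `tan(z, K) \ ldir(z, K)`. -/
def ComplementaryAndTangent (K : ProperCone ℝ Y) (A : X →ₗ[ℝ] Y) (b z : Y) : Prop :=
  (∃ u : Y, u ∈ LinearMap.ker (LinearMap.adjoint (opAb A b)) ∧ u ∈ dualCone (K : Set Y) ∧
    StrictlyComplementary K u z) ∧
  (LinearMap.range (opAb A b) : Set Y) ∩
    (tanSpace z (K : Set Y) \ ldir z (K : Set Y)) = ∅

end ConicSystem

end

/-! Homogenise: put `M = (A, b)`, so that a slack `b - A x` is `M (-x, 1)`. By the bipolar theorem,
closedness of `M* K*` says that every `g` nonnegative on `M⁻¹ K` has the form `M* y` with `y ∈ K*`.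
Closedness of `M* K*` gives closedness of the extended image, which gives good behaviour. For
polyhedral `K`, closedness is Farkas' lemma; under Slater's condition it is a compactness argument.

For a maximum slack `z`, the extended image being closed describes the dual of `{(x, t) | M (x, t) ∈
K, t ≥ 0}`, and `z` comes from a relative interior point of that cone; this excludes frontier
directions (`ClosedImageExtended.mem_dir`). Without frontier directions, `M*` maps the face `K* ∩
z^⊥` onto a subspace (`neg_mem_map_adjoint_exposedDualFace`), which yields the strictly
complementary `u`. Conversely, such a `u` forces each direction of `range M` in `cl dir(z, K)` into
the tangent space.

Niceness enters only in the return to closedness: with `F` the minimal face of `z`, it gives `F* =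
K* + F^⊥`. The set `M* F*` is closed because `z ∈ ri F`, and `M* F^⊥` is absorbed by the subspace
`M* (K* ∩ z^⊥)`. -/

namespace ConicSystem

/-! ### Relative interiors of convex sets and cones. -/

section RelativeInterior

variable {V : Type*} [NormedAddCommGroup V] [InnerProductSpace ℝ V]

theorem mem_intrinsicInterior_iff_exists_dist {S : Set V} {s : V} :
    s ∈ intrinsicInterior ℝ S ↔
      s ∈ S ∧ ∃ δ > 0, ∀ y ∈ affineSpan ℝ S, dist y s < δ → y ∈ S := by
  constructor
  · rintro ⟨y, hy, rfl⟩
    refine ⟨interior_subset (s := ((↑) ⁻¹' S : Set (affineSpan ℝ S))) hy, ?_⟩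
    obtain ⟨δ, hδ, h⟩ := Metric.isOpen_iff.1 isOpen_interior y hy
    exact ⟨δ, hδ, fun w hw hd => interior_subset (s := ((↑) ⁻¹' S : Set (affineSpan ℝ S))) (h (show (⟨w, hw⟩ : affineSpan ℝ S) ∈ _ from hd))⟩
  · rintro ⟨hs, δ, hδ, h⟩
    refine ⟨⟨s, subset_affineSpan _ _ hs⟩, ?_, rfl⟩
    refine mem_interior.2 ⟨Metric.ball ⟨s, subset_affineSpan _ _ hs⟩ δ, fun w hw => h w w.2 hw, Metric.isOpen_ball,
      Metric.mem_ball_self hδ⟩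

theorem exists_add_smul_sub_mem {S : Set V} {s w : V} (hs : s ∈ intrinsicInterior ℝ S)
    (hw : w ∈ S) : ∃ ε > (0 : ℝ), s + ε • (s - w) ∈ S := by
  obtain ⟨hsS, δ, hδ, h⟩ := mem_intrinsicInterior_iff_exists_dist.1 hs
  have hc : Filter.Tendsto (fun ε : ℝ => s + ε • (s - w)) (nhds 0) (nhds s) := by
    have : Continuous fun ε : ℝ => s + ε • (s - w) := by fun_prop
    simpa using this.tendsto 0
  obtain ⟨η, hη, hη'⟩ := Metric.eventually_nhds_iff.1 (hc.eventually (Metric.ball_mem_nhds s hδ))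
  refine ⟨η / 2, by positivity, h _ ?_ (hη' ?_)⟩
  · have := AffineMap.lineMap_mem (-(η / 2)) (subset_affineSpan ℝ S hsS) (subset_affineSpan ℝ S hw)
    convert this using 1
    simp only [AffineMap.lineMap_apply, vsub_eq_sub, vadd_eq_add]
    module
  · rw [Real.dist_eq, sub_zero, abs_of_pos (by positivity)]
    linarith

/-- Take `r` in the relative interior and prolong the segment from `r` past `s` inside `S`. The
homothety centred at the prolonged endpoint with ratio `ε / (1 + ε)` sends `r` to `s` and a relative
ball about `r` to one about `s`. -/
theorem mem_intrinsicInterior_of_forall_exists [FiniteDimensional ℝ V] {S : Set V}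
    (hS : Convex ℝ S) {s : V} (hs : s ∈ S)
    (h : ∀ w ∈ S, ∃ ε > (0 : ℝ), s + ε • (s - w) ∈ S) : s ∈ intrinsicInterior ℝ S := by
  obtain ⟨r, hr⟩ := Set.Nonempty.intrinsicInterior hS ⟨s, hs⟩
  obtain ⟨hrS, δ, hδ, hrδ⟩ := mem_intrinsicInterior_iff_exists_dist.1 hr
  obtain ⟨ε, hε, hw⟩ := h r hrS
  have hpos : 0 < 1 + ε := by positivity
  refine mem_intrinsicInterior_iff_exists_dist.2
    ⟨hs, δ * (ε / (1 + ε)), by positivity, fun y hy hd => ?_⟩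
  have hmem : r + ((1 + ε) / ε) • (y - s) ∈ S := by
    apply hrδ
    · have := AffineSubspace.smul_vsub_vadd_mem (affineSpan ℝ S) ((1 + ε) / ε) hy
        (subset_affineSpan ℝ S hs) (subset_affineSpan ℝ S hrS)
      simpa [add_comm] using this
    · rw [dist_eq_norm, add_sub_cancel_left, norm_smul, Real.norm_of_nonneg (by positivity),
        ← dist_eq_norm]
      calc (1 + ε) / ε * dist y s < (1 + ε) / ε * (δ * (ε / (1 + ε))) := by gcongr
        _ = δ := by field_simp
  have := hS hw hmem (a := 1 / (1 + ε)) (b := ε / (1 + ε)) (by positivity) (by positivity)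
    (by field_simp)
  convert this using 1
  match_scalars <;> field_simp <;> ring

theorem mem_intrinsicInterior_pointedCone_iff [FiniteDimensional ℝ V] {C : PointedCone ℝ V}
    {s : V} : s ∈ intrinsicInterior ℝ (C : Set V) ↔
      s ∈ C ∧ ∀ w ∈ C, ∃ ε > (0 : ℝ), s - ε • w ∈ C := by
  constructor
  · refine fun hs => ⟨intrinsicInterior_subset hs, fun w hw => ?_⟩
    obtain ⟨ε, hε, h⟩ := exists_add_smul_sub_mem hs hw
    refine ⟨ε / (1 + ε), by positivity, ?_⟩
    have := C.smul_mem (r := 1 / (1 + ε)) (by positivity) h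
    convert this using 1
    match_scalars <;> field_simp
  · rintro ⟨hs, h⟩
    refine mem_intrinsicInterior_of_forall_exists C.convex hs fun w hw => ?_
    obtain ⟨ε, hε, h'⟩ := h w hw
    refine ⟨ε, hε, ?_⟩
    have := C.add_mem h' (C.smul_mem hε.le hs)
    rw [show s + ε • (s - w) = s - ε • w + ε • s by module]
    exact this

theorem exists_add_mem_of_norm_lt {C : PointedCone ℝ V} {s : V}
    (hs : s ∈ intrinsicInterior ℝ (C : Set V)) :
    ∃ δ > 0, ∀ y ∈ Submodule.span ℝ (C : Set V), ‖y‖ < δ → s + y ∈ C := by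
  obtain ⟨hsC, δ, hδ, h⟩ := mem_intrinsicInterior_iff_exists_dist.1 hs
  refine ⟨δ, hδ, fun y hy hn => h _ ?_ (by simpa [dist_eq_norm] using hn)⟩
  have h0 : affineSpan ℝ (C : Set V) = (Submodule.span ℝ (C : Set V)).toAffineSubspace := by
    ext w
    rw [← SetLike.mem_coe, ← Set.insert_eq_of_mem (s := (C : Set V)) C.zero_mem,
      affineSpan_insert_zero, Set.insert_eq_of_mem (s := (C : Set V)) C.zero_mem]
    rfl
  rw [h0]
  exact Submodule.add_mem _ (Submodule.subset_span hsC) hy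

end RelativeInterior

/-! ### Farkas' lemma and bipolarity. -/

section Duality

variable {V : Type*} [NormedAddCommGroup V] [InnerProductSpace ℝ V]

theorem inner_nonneg_of_mem_closure {S : Set V} {g u : V} (hg : g ∈ closure S)
    (h : ∀ w ∈ S, 0 ≤ ⟪w, u⟫) : 0 ≤ ⟪g, u⟫ := by
  have : IsClosed {w : V | 0 ≤ ⟪w, u⟫} := isClosed_le (by fun_prop) (by fun_prop)
  exact closure_minimal h this hg

/-- Farkas' lemma for finitely many inequalities. -/
theorem mem_span_of_forall_inner {ι : Type*} (s : Finset ι) (a : ι → V) (g : V)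
    (h : ∀ x, (∀ i ∈ s, 0 ≤ ⟪a i, x⟫) → 0 ≤ ⟪g, x⟫) :
    g ∈ Submodule.span NNReal (a '' s) := by
  classical
  induction s using Finset.induction_on generalizing a g with
  | empty =>
    have := h (-g) (by simp)
    rw [inner_neg_right, Left.nonneg_neg_iff, real_inner_self_nonpos] at this
    simp [this]
  | insert j s hj ih =>
    by_cases hg : ∀ x, (∀ i ∈ s, 0 ≤ ⟪a i, x⟫) → 0 ≤ ⟪g, x⟫
    · exact Submodule.span_mono (Set.image_mono (by simp)) (ih a g hg)
    push Not at hg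
    obtain ⟨q, hq, hgq⟩ := hg
    have hjq : ⟪a j, q⟫ < 0 := by
      by_contra hjq
      exact hgq.not_ge (h q (by simpa using ⟨not_lt.1 hjq, hq⟩))
    obtain ⟨p, hp, hgp, hjp⟩ : ∃ p, (∀ i ∈ s, 0 ≤ ⟪a i, p⟫) ∧ ⟪g, p⟫ < 0 ∧ ⟪a j, p⟫ = -1 := by
      have hpos : 0 < (-⟪a j, q⟫)⁻¹ := by rw [inv_pos]; linarith
      refine ⟨(-⟪a j, q⟫)⁻¹ • q, fun i hi => ?_, ?_, ?_⟩
      · rw [inner_smul_right]; exact mul_nonneg hpos.le (hq i hi)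
      · rw [inner_smul_right]; exact mul_neg_of_pos_of_neg hpos hgq
      · rw [inner_smul_right]; have := hjq.ne; field_simp
    -- The map `x ↦ x + ⟪a j, x⟫ • p` projects onto the hyperplane `⟪a j, ·⟫ = 0`; the new vectors
    -- are the old functionals composed with it. As `⟪a i, p⟫ ≥ 0 > ⟪g, p⟫`, undoing the change only
    -- adds nonnegative multiples of `a j`.
    have key := ih (fun i => a i + ⟪a i, p⟫ • a j) (g + ⟪g, p⟫ • a j) fun x hx => by
      have := h (x + ⟪a j, x⟫ • p) fun i hi => by
        rcases Finset.mem_insert.1 hi with rfl | hi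
        · rw [inner_add_right, inner_smul_right, hjp]; simp
        · have := hx i hi
          rw [inner_add_left, real_inner_smul_left] at this
          rw [inner_add_right, inner_smul_right]
          linarith
      rw [inner_add_right, inner_smul_right] at this
      rw [inner_add_left, real_inner_smul_left]
      linarith
    have hjmem : a j ∈ Submodule.span NNReal (a '' (insert j s : Finset ι)) :=
      Submodule.subset_span ⟨j, by simp, rfl⟩
    have hle : Submodule.span NNReal ((fun i => a i + ⟪a i, p⟫ • a j) '' s) ≤
        Submodule.span NNReal (a '' (insert j s : Finset ι)) := by
      rw [Submodule.span_le]
      rintro _ ⟨i, hi, rfl⟩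
      exact Submodule.add_mem _ (Submodule.subset_span ⟨i, by simpa using .inr hi, rfl⟩)
        (Submodule.smul_mem _ (⟨⟪a i, p⟫, hp i hi⟩ : NNReal) hjmem)
    have := Submodule.add_mem _ (hle key)
      (Submodule.smul_mem _ (⟨-⟪g, p⟫, by linarith⟩ : NNReal) hjmem)
    convert this using 1
    change _ = _ + (-⟪g, p⟫) • a j
    module

variable [FiniteDimensional ℝ V]

theorem mem_closure_of_forall_inner (C : PointedCone ℝ V) {g : V}
    (h : ∀ u, (∀ w ∈ C, 0 ≤ ⟪w, u⟫) → 0 ≤ ⟪g, u⟫) : g ∈ closure (C : Set V) := by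
  by_contra hg
  obtain ⟨u, hu, hgu⟩ := ProperCone.hyperplane_separation'
    (C := (⟨C.closure, isClosed_closure⟩ : ProperCone ℝ V)) (x₀ := g) hg
  exact hgu.not_ge (h u fun w hw => hu w (subset_closure hw))

theorem mem_properCone_of_forall_inner (C : ProperCone ℝ V) {g : V}
    (h : ∀ u ∈ dualCone (C : Set V), 0 ≤ ⟪g, u⟫) : g ∈ C := by
  have := mem_closure_of_forall_inner C.toPointedCone (g := g) h
  exact C.isClosed.closure_subset this

/-- The dual cone as a pointed cone. -/
noncomputable def dualPointedCone (S : Set V) : PointedCone ℝ V := (ProperCone.innerDual S).toPointedCone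

theorem isClosed_dualCone (S : Set V) : IsClosed (dualCone S) :=
  (ProperCone.innerDual S).isClosed

/-- A point that is nonnegative on the part of the dual cone orthogonal to a relative interior
point `a` is a feasible direction at `a`. -/
theorem exists_add_smul_mem {C : PointedCone ℝ V} {a k : V}
    (ha : ∀ w ∈ C, ∃ ε > (0 : ℝ), a - ε • w ∈ C)
    (hk : ∀ g, (∀ w ∈ C, 0 ≤ ⟪w, g⟫) → ⟪a, g⟫ = 0 → 0 ≤ ⟪k, g⟫) (haC : a ∈ C) :
    ∃ ε > (0 : ℝ), a + ε • k ∈ C := by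
  -- It suffices to test `hk` on `g` and `-g` for `g` orthogonal to `C`. Then `k = d - e` with `d, e
  -- ∈ C`, and `a` absorbs a small multiple of `e`.
  have hspan : k ∈ Submodule.span ℝ (C : Set V) := by
    rw [← Submodule.orthogonal_orthogonal (Submodule.span ℝ (C : Set V))]
    intro g hg
    have hg' : ∀ w ∈ C, ⟪w, g⟫ = 0 := fun w hw => hg w (Submodule.subset_span hw)
    have h1 := hk g (fun w hw => (hg' w hw).ge) (hg' a haC)
    have h2 := hk (-g) (fun w hw => by simp [hg' w hw]) (by simp [hg' a haC])
    rw [inner_neg_right] at h2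
    rw [real_inner_comm]
    linarith
  have hdiff : ∃ d ∈ C, ∃ e ∈ C, k = d - e := by
    clear hk
    induction hspan using Submodule.span_induction with
    | mem x hx => exact ⟨x, hx, 0, C.zero_mem, by simp⟩
    | zero => exact ⟨0, C.zero_mem, 0, C.zero_mem, by simp⟩
    | add x y _ _ hx hy =>
      obtain ⟨d, hd, e, he, rfl⟩ := hx
      obtain ⟨d', hd', e', he', rfl⟩ := hy
      exact ⟨d + d', C.add_mem hd hd', e + e', C.add_mem he he', by abel⟩
    | smul r x _ hx =>
      obtain ⟨d, hd, e, he, rfl⟩ := hx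
      rcases le_total 0 r with hr | hr
      · exact ⟨r • d, C.smul_mem hr hd, r • e, C.smul_mem hr he, smul_sub _ _ _⟩
      · have hr' : 0 ≤ -r := by linarith
        exact ⟨(-r) • e, C.smul_mem hr' he, (-r) • d, C.smul_mem hr' hd, by module⟩
  obtain ⟨d, hd, e, he, rfl⟩ := hdiff
  obtain ⟨ε, hε, h⟩ := ha e he
  refine ⟨ε, hε, ?_⟩
  have := C.add_mem h (C.smul_mem hε.le hd)
  convert this using 1
  module

/-- A convex cone whose dual cone is a subspace is itself a subspace. -/
theorem neg_mem_of_dual_symm {C : PointedCone ℝ V}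
    (h : ∀ u, (∀ w ∈ C, 0 ≤ ⟪w, u⟫) → ∀ w ∈ C, ⟪w, u⟫ = 0) : ∀ w ∈ C, -w ∈ C := by
  obtain ⟨s, hs⟩ := Set.Nonempty.intrinsicInterior C.convex ⟨0, C.zero_mem⟩
  obtain ⟨hsC, hsw⟩ := mem_intrinsicInterior_pointedCone_iff.1 hs
  obtain ⟨δ, hδ, hδs⟩ := exists_add_mem_of_norm_lt hs
  have hcl : -s ∈ closure (C : Set V) :=
    mem_closure_of_forall_inner C fun u hu => by simp [h u hu s hsC]
  obtain ⟨s', hs', hd⟩ := Metric.mem_closure_iff.1 hcl (δ / 2) (by positivity)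
  -- The perturbation has norm below `δ` because `s'` is within `δ / 2` of `-s`; adding `2 • s'`
  -- afterwards leaves exactly `-s`.
  have hm : s + (2 : ℝ) • (-s - s') ∈ C := by
    refine hδs _ (Submodule.smul_mem _ _ (Submodule.sub_mem _ (Submodule.neg_mem _
      (Submodule.subset_span hsC)) (Submodule.subset_span hs'))) ?_
    rw [norm_smul, Real.norm_of_nonneg (by norm_num), ← dist_eq_norm]
    linarith
  have hns : -s ∈ C := by
    have := C.add_mem (C.smul_mem (r := 2) (by norm_num) hs') hm
    convert this using 1
    module
  intro w hw
  obtain ⟨ε, hε, hεw⟩ := hsw w hw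
  have := C.smul_mem (r := ε⁻¹) (by positivity) (C.add_mem hεw hns)
  convert this using 1
  match_scalars
  · field_simp
  · field_simp
    ring

theorem isClosed_of_neg_mem {C : PointedCone ℝ V} (h : ∀ w ∈ C, -w ∈ C) :
    IsClosed (C : Set V) := by
  let W : Submodule ℝ V :=
    { carrier := C
      add_mem' := C.add_mem
      zero_mem' := C.zero_mem
      smul_mem' := fun r x hx => by
        rcases le_total 0 r with hr | hr
        · exact C.smul_mem hr hx
        · simpa using h _ (C.smul_mem (neg_nonneg.2 hr) hx) }
  exact W.closed_of_finiteDimensional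

end Duality

/-! ### Feasible directions, minimal faces and exposed dual faces. -/

section Faces

variable {Y : Type*} [NormedAddCommGroup Y] [InnerProductSpace ℝ Y] {K : ProperCone ℝ Y}

theorem mem_perp_iff {S : Set Y} {u : Y} : u ∈ perp S ↔ ∀ w ∈ S, ⟪w, u⟫ = 0 := by
  rw [perp, Submodule.mem_orthogonal]
  refine ⟨fun h w hw => h w (Submodule.subset_span hw), fun h w hw => ?_⟩
  induction hw using Submodule.span_induction with
  | mem x hx => exact h x hx
  | zero => simp
  | add x y _ _ hx hy => rw [inner_add_left, hx, hy, add_zero]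
  | smul r x _ hx => rw [real_inner_smul_left, hx, mul_zero]

/-- The cone of feasible directions at `z`. -/
def dirCone (K : ProperCone ℝ Y) {z : Y} (hz : z ∈ K) : PointedCone ℝ Y where
  carrier := dir z (K : Set Y)
  zero_mem' := ⟨1, one_pos, by simpa using hz⟩
  add_mem' := by
    rintro v w ⟨ε, hε, hv⟩ ⟨η, hη, hw⟩
    refine ⟨ε * η / (ε + η), by positivity, ?_⟩
    have := K.convex hv hw (a := η / (ε + η)) (b := ε / (ε + η)) (by positivity) (by positivity)
      (by field_simp; ring)
    convert this using 1
    match_scalars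
    · field_simp
      ring
    · field_simp
    · field_simp
  smul_mem' := by
    rintro ⟨r, hr⟩ v ⟨ε, hε, hv⟩
    change ∃ _, _ ∧ z + _ • r • v ∈ (K : Set Y)
    rcases hr.eq_or_lt with rfl | hr
    · exact ⟨1, one_pos, by simpa using hz⟩
    · refine ⟨ε / r, by positivity, ?_⟩
      rwa [smul_smul, div_mul_cancel₀ _ hr.ne']

theorem mem_dir_of_mem {z w : Y} (hz : z ∈ K) (hw : w ∈ K) : w ∈ dir z (K : Set Y) :=
  ⟨1, one_pos, by simpa using K.toPointedCone.add_mem hz hw⟩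

/-- The minimal face of `K` that contains `z`. -/
def minimalFace (K : ProperCone ℝ Y) (z : Y) : PointedCone ℝ Y where
  carrier := {w | w ∈ K ∧ ∃ r : ℝ, 0 ≤ r ∧ r • z - w ∈ K}
  zero_mem' := ⟨K.toPointedCone.zero_mem, 0, le_rfl, by simp⟩
  add_mem' := by
    rintro v w ⟨hv, r, hr, hrv⟩ ⟨hw, t, ht, htw⟩
    refine ⟨K.toPointedCone.add_mem hv hw, r + t, by positivity, ?_⟩
    rw [show (r + t) • z - (v + w) = r • z - v + (t • z - w) by module]
    exact K.toPointedCone.add_mem hrv htw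
  smul_mem' := by
    rintro ⟨s, hs⟩ v ⟨hv, r, hr, hrv⟩
    refine ⟨K.smul_mem hv hs, s * r, by positivity, ?_⟩
    convert K.smul_mem hrv hs using 1
    change _ - s • v = _
    module

theorem minimalFace_isFaceOf (z : Y) : (minimalFace K z).IsFaceOf K.toPointedCone where
  le _ hw := hw.1
  mem_of_smul_add_mem := by
    rintro u v α hu hv hα ⟨-, r, hr, h⟩
    refine ⟨hu, r / α, by positivity, ?_⟩
    convert K.smul_mem (K.toPointedCone.add_mem h hv) (inv_nonneg.2 hα.le) using 1
    match_scalars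
    · field_simp
    · field_simp
    · field_simp
      simp

/-- The face of the dual cone exposed by `z`. -/
def exposedDualFace (K : ProperCone ℝ Y) (z : Y) : PointedCone ℝ Y where
  carrier := {u | u ∈ dualCone (K : Set Y) ∧ ⟪z, u⟫ = 0}
  zero_mem' := ⟨fun _ _ => by simp, by simp⟩
  add_mem' hu hv := ⟨fun w hw => by
    rw [inner_add_right]; exact add_nonneg (hu.1 w hw) (hv.1 w hw), by
    rw [inner_add_right, hu.2, hv.2, add_zero]⟩
  smul_mem' := by
    rintro ⟨r, hr⟩ u ⟨hu, hu0⟩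
    refine ⟨fun w hw => ?_, ?_⟩
    · change 0 ≤ ⟪w, r • u⟫
      rw [inner_smul_right]; exact mul_nonneg hr (hu w hw)
    · change ⟪z, r • u⟫ = 0
      rw [inner_smul_right, hu0, mul_zero]

end Faces

/-! ### Images of dual cones under an adjoint map. -/

section LinearImage

variable {V Y : Type*}
  [NormedAddCommGroup V] [InnerProductSpace ℝ V] [FiniteDimensional ℝ V]
  [NormedAddCommGroup Y] [InnerProductSpace ℝ Y] [FiniteDimensional ℝ Y]
  {K : ProperCone ℝ Y} {M : V →ₗ[ℝ] Y}

/-- On the part of the dual cone inside `span C`, the functional `⟪M a, ·⟫` dominates a multiple of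
the norm, so its sublevel sets are compact. The rest of the dual cone is the subspace `C^⊥`. Since
`⟪M a, y⟫ = ⟪a, M* y⟫`, the image near a given point lies in a compact set plus a subspace. -/
theorem isClosed_adjoint_image_of_mem_intrinsicInterior (C : PointedCone ℝ Y) {a : V}
    (ha : M a ∈ intrinsicInterior ℝ (C : Set Y)) :
    IsClosed (LinearMap.adjoint M '' dualCone (C : Set Y)) := by
  obtain ⟨δ, hδ, hball⟩ := exists_add_mem_of_norm_lt ha
  have hbound : ∀ y ∈ dualCone (C : Set Y), y ∈ Submodule.span ℝ (C : Set Y) →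
      δ / 2 * ‖y‖ ≤ ⟪M a, y⟫ := by
    intro y hy hyC
    rcases eq_or_ne y 0 with rfl | hy0
    · simp
    have hpos : 0 < ‖y‖ := norm_pos_iff.2 hy0
    have := hy _ (hball ((-(δ / 2 / ‖y‖)) • y) (Submodule.smul_mem _ _ hyC) (by
      rw [norm_smul, norm_neg, Real.norm_of_nonneg (by positivity)]
      field_simp
      linarith))
    rw [inner_add_left, real_inner_smul_left, real_inner_self_eq_norm_sq] at this
    have e : δ / 2 / ‖y‖ * ‖y‖ ^ 2 = δ / 2 * ‖y‖ := by field_simp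
    linarith
  let Q : ℝ → Set Y := fun R => {y | y ∈ dualCone (C : Set Y) ∧
    y ∈ Submodule.span ℝ (C : Set Y) ∧ ⟪M a, y⟫ ≤ R}
  have hQ : ∀ R, IsCompact (Q R) := by
    intro R
    refine Metric.isCompact_of_isClosed_isBounded ?_ ?_
    · refine (isClosed_dualCone _).inter
        ((Submodule.closed_of_finiteDimensional (Submodule.span ℝ (C : Set Y))).inter
          (isClosed_le (f := fun y => ⟪M a, y⟫) (by fun_prop) continuous_const))
    · refine isBounded_iff_forall_norm_le.2 ⟨R / (δ / 2), fun y hy => ?_⟩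
      rw [le_div_iff₀ (by positivity), mul_comm]
      exact (hbound y hy.1 hy.2.1).trans hy.2.2
  have hcont : Continuous (LinearMap.adjoint M) := LinearMap.continuous_of_finiteDimensional _
  refine isClosed_of_closure_subset fun c hc => ?_
  -- Any level above `⟪a, c⟫` works: points of the image near `c` then come from `Q R` up to `C^⊥`.
  let R := ⟪a, c⟫ + 1
  have hT : IsClosed (LinearMap.adjoint M '' Q R +
      (((perp (C : Set Y)).map (LinearMap.adjoint M) : Submodule ℝ V) : Set V)) :=
    ((Submodule.closed_of_finiteDimensional _).add_left_of_isCompact ((hQ R).image hcont))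
  have hU : IsOpen {g : V | ⟪a, g⟫ < R} := isOpen_lt (by fun_prop) continuous_const
  have hcT : c ∈ closure (LinearMap.adjoint M '' Q R +
      (((perp (C : Set Y)).map (LinearMap.adjoint M) : Submodule ℝ V) : Set V)) := by
    refine closure_mono ?_ (hU.inter_closure ⟨(by simp [R] : ⟪a, c⟫ < R), hc⟩)
    rintro _ ⟨hlt, y, hy, rfl⟩
    obtain ⟨y₁, hy₁, y₂, hy₂, rfl⟩ :=
      (Submodule.span ℝ (C : Set Y)).exists_add_mem_mem_orthogonal y
    have horth : ∀ w ∈ (C : Set Y), ⟪w, y₂⟫ = 0 := fun w hw => hy₂ w (Submodule.subset_span hw)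
    have hlt' : ⟪a, LinearMap.adjoint M (y₁ + y₂)⟫ < R := hlt
    rw [LinearMap.adjoint_inner_right, inner_add_right,
      horth _ (intrinsicInterior_subset ha), add_zero] at hlt'
    rw [map_add]
    refine Set.add_mem_add ⟨y₁, ⟨fun w hw => ?_, hy₁, hlt'.le⟩, rfl⟩ ⟨y₂, hy₂, rfl⟩
    have := hy w hw
    rwa [inner_add_right, horth w hw, add_zero] at this
  rw [hT.closure_eq] at hcT
  obtain ⟨_, ⟨y₁, hy₁, rfl⟩, _, ⟨y₂, hy₂, rfl⟩, rfl⟩ := hcT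
  refine ⟨y₁ + y₂, fun w hw => ?_, map_add _ _ _⟩
  rw [inner_add_right, mem_perp_iff.1 hy₂ w hw, add_zero]
  exact hy₁.1 w hw

/-- The bipolar theorem for the image of a cone under an adjoint map. -/
theorem mem_closure_adjoint_image (C : PointedCone ℝ Y) {g : V}
    (h : ∀ p, (∀ y ∈ C, 0 ≤ ⟪M p, y⟫) → 0 ≤ ⟪p, g⟫) :
    g ∈ closure (LinearMap.adjoint M '' (C : Set Y)) := by
  refine mem_closure_of_forall_inner (C.map (LinearMap.adjoint M)) fun u hu => ?_
  rw [real_inner_comm]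
  refine h u fun y hy => ?_
  have := hu _ ⟨y, hy, rfl⟩
  rwa [← LinearMap.adjoint_inner_right, real_inner_comm]

/-- The closure of the image is the dual cone of `M ⁻¹' K`, which turns closedness into solvability
of `M* y = g`. -/
theorem isClosed_adjoint_image_dualCone_iff :
    IsClosed (LinearMap.adjoint M '' dualCone (K : Set Y)) ↔
      ∀ g, (∀ p, M p ∈ K → 0 ≤ ⟪p, g⟫) → g ∈ LinearMap.adjoint M '' dualCone (K : Set Y) := by
  constructor
  · intro hcl g hg
    rw [← hcl.closure_eq]
    exact mem_closure_adjoint_image (dualPointedCone (K : Set Y)) fun p hp =>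
      hg p (mem_properCone_of_forall_inner K hp)
  · intro h
    have : LinearMap.adjoint M '' dualCone (K : Set Y) = dualCone (M ⁻¹' (K : Set Y)) := by
      refine Set.Subset.antisymm ?_ fun g hg => h g hg
      rintro _ ⟨y, hy, rfl⟩ p hp
      rw [LinearMap.adjoint_inner_right]
      exact hy _ hp
    rw [this]
    exact isClosed_dualCone _

theorem isClosed_adjoint_image_dualCone_of_isPolyhedral (hK : IsPolyhedral K) :
    IsClosed (LinearMap.adjoint M '' dualCone (K : Set Y)) := by
  obtain ⟨s, hs⟩ := hK
  refine isClosed_adjoint_image_dualCone_iff.2 fun g hg => ?_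
  have hmem := mem_span_of_forall_inner s (fun a => LinearMap.adjoint M a) g fun p hp => by
    rw [real_inner_comm]
    refine hg p ?_
    rw [← SetLike.mem_coe, hs]
    intro a ha
    rw [← LinearMap.adjoint_inner_left]
    exact hp a ha
  have hle : Submodule.span NNReal ((fun a => LinearMap.adjoint M a) '' (s : Set Y)) ≤
      (dualPointedCone (K : Set Y)).map (LinearMap.adjoint M) := by
    refine Submodule.span_le.2 ?_
    rintro _ ⟨a, ha, rfl⟩
    refine ⟨a, fun x hx => ?_, rfl⟩
    rw [hs] at hx
    change 0 ≤ ⟪x, a⟫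
    rw [real_inner_comm]
    exact hx a ha
  exact hle hmem

/-- The dual cone of `dir z K` is `K* ∩ z^⊥`, because `dir z K` contains both `K` and `-z`. -/
theorem mem_closure_dir_iff {z y : Y} (hz : z ∈ K) :
    y ∈ closure (dir z (K : Set Y)) ↔
      ∀ u ∈ dualCone (K : Set Y), ⟪z, u⟫ = 0 → 0 ≤ ⟪y, u⟫ := by
  constructor
  · intro hy u hu hzu
    refine inner_nonneg_of_mem_closure hy ?_
    rintro w ⟨ε, hε, hw⟩
    have := hu _ hw
    rw [inner_add_left, real_inner_smul_left, hzu, zero_add] at this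
    exact nonneg_of_mul_nonneg_right this hε
  · intro h
    refine mem_closure_of_forall_inner (dirCone K hz) fun u hu => ?_
    have hu' : u ∈ dualCone (K : Set Y) := fun w hw => hu w (mem_dir_of_mem hz hw)
    have hz' := hu (-z) ⟨1, one_pos, by simp⟩
    rw [inner_neg_left] at hz'
    exact h u hu' (le_antisymm (by linarith) (hu' z hz))

theorem mem_intrinsicInterior_minimalFace {z : Y} (hz : z ∈ K) :
    z ∈ intrinsicInterior ℝ (minimalFace K z : Set Y) := by
  have hzF : z ∈ minimalFace K z :=
    ⟨hz, 1, zero_le_one, by simp⟩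
  refine mem_intrinsicInterior_pointedCone_iff.2 ⟨hzF, ?_⟩
  rintro w ⟨hw, r, hr, h⟩
  refine ⟨1 / (1 + r), by positivity, ?_, 1, zero_le_one, ?_⟩
  · convert K.smul_mem (K.toPointedCone.add_mem h hz) (r := 1 / (1 + r)) (by positivity) using 1
    match_scalars <;> field_simp
    ring
  · convert K.smul_mem hw (r := 1 / (1 + r)) (by positivity) using 1
    module

/-- A functional nonnegative on `E` and zero at a relative interior point vanishes on `E`. Hence the
conjugate face depends only on `z`. -/
theorem mem_conjugateFace_iff {E : PointedCone ℝ Y} (hE : E ≤ K.toPointedCone) {z u : Y}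
    (hz : z ∈ intrinsicInterior ℝ (E : Set Y)) :
    u ∈ conjugateFace K E ↔ u ∈ dualCone (K : Set Y) ∧ ⟪z, u⟫ = 0 := by
  obtain ⟨hzE, hzw⟩ := mem_intrinsicInterior_pointedCone_iff.1 hz
  refine ⟨fun hu => ⟨hu.1, mem_perp_iff.1 hu.2 z hzE⟩, fun hu => ⟨hu.1, ?_⟩⟩
  refine mem_perp_iff.2 fun w hw => le_antisymm ?_ (hu.1 w (hE hw))
  obtain ⟨ε, hε, h⟩ := hzw w hw
  have := hu.1 _ (hE h)
  rw [inner_sub_left, real_inner_smul_left, hu.2, zero_sub] at this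
  by_contra hlt
  nlinarith [mul_pos hε (not_le.1 hlt)]

theorem coe_exposedDualFace_eq_conjugateFace {E : PointedCone ℝ Y} (hE : E ≤ K.toPointedCone)
    {z : Y} (hz : z ∈ intrinsicInterior ℝ (E : Set Y)) :
    (exposedDualFace K z : Set Y) = conjugateFace K E :=
  Set.ext fun _ => (mem_conjugateFace_iff hE hz).symm

theorem mem_closure_dir_iff_forall_exposedDualFace {z y : Y} (hz : z ∈ K) :
    y ∈ closure (dir z (K : Set Y)) ↔ ∀ u ∈ exposedDualFace K z, 0 ≤ ⟪y, u⟫ :=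
  (mem_closure_dir_iff hz).trans
    ⟨fun h u hu => h u hu.1 hu.2, fun h u hu hzu => h u ⟨hu, hzu⟩⟩

end LinearImage

/-! ### Frontier directions, strict complementarity and niceness. -/

section LinearImage

variable {V Y : Type*}
  [NormedAddCommGroup V] [InnerProductSpace ℝ V] [NormedAddCommGroup Y] [InnerProductSpace ℝ Y]
  {K : ProperCone ℝ Y} {M : V →ₗ[ℝ] Y}

theorem inner_eq_zero_of_add_smul_mem_minimalFace {z y u : Y} {ε : ℝ} (hε : 0 < ε)
    (h : z + ε • y ∈ minimalFace K z) (hu : u ∈ exposedDualFace K z) : ⟪y, u⟫ = 0 := by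
  obtain ⟨h1, r, hr, h2⟩ := h
  have h1' := hu.1 _ h1
  have h2' := hu.1 _ h2
  rw [inner_add_left, real_inner_smul_left, hu.2, zero_add] at h1'
  rw [inner_sub_left, inner_add_left, real_inner_smul_left, real_inner_smul_left, hu.2] at h2'
  have : ε * ⟪y, u⟫ = 0 := by linarith
  exact (mul_eq_zero.1 this).resolve_left hε.ne'

theorem range_inter_tanSpace_sdiff_ldir_eq_empty {z : Y}
    (hfr : ∀ p, M p ∈ closure (dir z (K : Set Y)) → M p ∈ dir z (K : Set Y)) :
    (LinearMap.range M : Set Y) ∩ (tanSpace z (K : Set Y) \ ldir z (K : Set Y)) = ∅ := by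
  refine Set.eq_empty_iff_forall_notMem.2 ?_
  rintro _ ⟨⟨p, rfl⟩, ⟨h1, h2⟩, hnot⟩
  refine hnot ⟨hfr p h1, ?_⟩
  have := hfr (-p) (by simpa using h2)
  simpa using this

variable [FiniteDimensional ℝ Y]

/-- The hypothesis `ha` is maximality of `M a` in `K ∩ range M`. Applied to the feasible point `a +
ε • p`, it bounds `M a + ε • M p` by a multiple of `M a`. -/
theorem exists_add_smul_mem_minimalFace {a : V} (haK : M a ∈ K)
    (ha : ∀ p, M p ∈ K → ∃ ε > (0 : ℝ), M a - ε • M p ∈ K)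
    (hfr : ∀ p, M p ∈ closure (dir (M a) (K : Set Y)) → M p ∈ dir (M a) (K : Set Y)) {p : V}
    (hp : ∀ u ∈ exposedDualFace K (M a), 0 ≤ ⟪M p, u⟫) :
    ∃ ε > (0 : ℝ), M a + ε • M p ∈ minimalFace K (M a) := by
  obtain ⟨ε, hε, h⟩ := hfr p ((mem_closure_dir_iff_forall_exposedDualFace haK).2 hp)
  obtain ⟨η, hη, h'⟩ := ha (a + ε • p) (by simpa using h)
  refine ⟨ε, hε, h, η⁻¹, by positivity, ?_⟩
  convert K.smul_mem h' (inv_nonneg.2 hη.le) using 1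
  simp only [map_add, map_smul]
  match_scalars <;> field_simp

variable [FiniteDimensional ℝ V]

/-- If no direction in the range of `M` is a nonfeasible limit of feasible directions, then the
image of the exposed dual face is a subspace. -/
theorem neg_mem_map_adjoint_exposedDualFace {a : V} (haK : M a ∈ K)
    (ha : ∀ p, M p ∈ K → ∃ ε > (0 : ℝ), M a - ε • M p ∈ K)
    (hfr : ∀ p, M p ∈ closure (dir (M a) (K : Set Y)) → M p ∈ dir (M a) (K : Set Y)) :
    ∀ w ∈ (exposedDualFace K (M a)).map (LinearMap.adjoint M),
      -w ∈ (exposedDualFace K (M a)).map (LinearMap.adjoint M) := by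
  -- A dual vector `p` of the image gives a direction `M p` in `cl dir`; it stays in the minimal
  -- face, to which the exposed dual face is orthogonal.
  refine neg_mem_of_dual_symm fun p hp => ?_
  obtain ⟨ε, hε, h⟩ := exists_add_smul_mem_minimalFace haK ha hfr (p := p) fun u hu => by
    rw [← LinearMap.adjoint_inner_right, real_inner_comm]
    exact hp _ ⟨u, hu, rfl⟩
  rintro _ ⟨u, hu, rfl⟩
  have := inner_eq_zero_of_add_smul_mem_minimalFace hε h hu
  rwa [← LinearMap.adjoint_inner_right, real_inner_comm] at this

/-- The image of the exposed dual face is a subspace, so `M* u₀`, with `u₀` in the relative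
interior, is cancelled by some `M* u₁`. Adding an element of a cone to a relative interior point
keeps it in the relative interior. -/
theorem exists_strictlyComplementary {a : V} (haK : M a ∈ K)
    (ha : ∀ p, M p ∈ K → ∃ ε > (0 : ℝ), M a - ε • M p ∈ K)
    (hfr : ∀ p, M p ∈ closure (dir (M a) (K : Set Y)) → M p ∈ dir (M a) (K : Set Y)) :
    ∃ u : Y, u ∈ LinearMap.ker (LinearMap.adjoint M) ∧ u ∈ dualCone (K : Set Y) ∧
      StrictlyComplementary K u (M a) := by
  obtain ⟨u₀, hu₀⟩ := Set.Nonempty.intrinsicInterior (exposedDualFace K (M a)).convex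
    ⟨0, (exposedDualFace K (M a)).zero_mem⟩
  obtain ⟨hu₀F, hint⟩ := mem_intrinsicInterior_pointedCone_iff.1 hu₀
  obtain ⟨u₁, hu₁, heq⟩ := neg_mem_map_adjoint_exposedDualFace haK ha hfr _ ⟨u₀, hu₀F, rfl⟩
  have heq' : LinearMap.adjoint M u₁ = -LinearMap.adjoint M u₀ := heq
  have hmem := (exposedDualFace K (M a)).add_mem hu₀F hu₁
  refine ⟨u₀ + u₁, ?_, hmem.1, minimalFace K (M a), minimalFace_isFaceOf _,
    mem_intrinsicInterior_minimalFace haK, ?_⟩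
  · rw [LinearMap.mem_ker, map_add, heq', add_neg_cancel]
  · rw [← coe_exposedDualFace_eq_conjugateFace (minimalFace_isFaceOf _).le
      (mem_intrinsicInterior_minimalFace haK)]
    refine mem_intrinsicInterior_pointedCone_iff.2 ⟨hmem, fun w hw => ?_⟩
    obtain ⟨ε, hε, h⟩ := hint w hw
    refine ⟨ε, hε, ?_⟩
    rw [add_sub_right_comm]
    exact (exposedDualFace K (M a)).add_mem h hu₁

/-- The functional `⟪M p, ·⟫` is nonnegative on the exposed dual face and zero at its relative
interior point `u`, since `M* u = 0`. So it vanishes on the face and `M p` is tangent. -/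
theorem mem_dir_of_strictlyComplementary {z u : Y} (hz : z ∈ K)
    (hker : u ∈ LinearMap.ker (LinearMap.adjoint M)) (hsc : StrictlyComplementary K u z)
    (htan : (LinearMap.range M : Set Y) ∩ (tanSpace z (K : Set Y) \ ldir z (K : Set Y)) = ∅)
    {p : V} (hp : M p ∈ closure (dir z (K : Set Y))) : M p ∈ dir z (K : Set Y) := by
  obtain ⟨E, hE, hzE, hu⟩ := hsc
  rw [← coe_exposedDualFace_eq_conjugateFace hE.le hzE] at hu
  obtain ⟨huF, hint⟩ := mem_intrinsicInterior_pointedCone_iff.1 hu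
  have hp' := (mem_closure_dir_iff_forall_exposedDualFace hz).1 hp
  have hpu : ⟪M p, u⟫ = 0 := by
    rw [← LinearMap.adjoint_inner_right, LinearMap.mem_ker.1 hker, inner_zero_right]
  have hneg : -M p ∈ closure (dir z (K : Set Y)) := by
    refine (mem_closure_dir_iff_forall_exposedDualFace hz).2 fun w hw => ?_
    obtain ⟨ε, hε, h⟩ := hint w hw
    have := hp' _ h
    rw [inner_sub_right, hpu, inner_smul_right] at this
    rw [inner_neg_left]
    refine nonneg_of_mul_nonneg_right (?_ : 0 ≤ ε * _) hε
    linarith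
  by_contra hnot
  have : M p ∈ (LinearMap.range M : Set Y) ∩
      (tanSpace z (K : Set Y) \ ldir z (K : Set Y)) :=
    ⟨⟨p, rfl⟩, ⟨hp, hneg⟩, fun h => hnot h.1⟩
  rw [htan] at this
  exact this

/-- For a nice cone, the dual of the minimal face decomposes. -/
theorem exists_add_of_mem_dualCone_minimalFace (hK : IsNice K) {z e : Y} (hz : z ∈ K)
    (he : e ∈ dualCone (minimalFace K z : Set Y)) :
    ∃ k ∈ dualCone (K : Set Y), ∃ w ∈ perp (minimalFace K z : Set Y), k + w = e := by
  let P : PointedCone ℝ Y := dualPointedCone (K : Set Y) ⊔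
    (perp (minimalFace K z : Set Y)).restrictScalars _
  have hP : (P : Set Y) = dualCone (K : Set Y) + (perp (minimalFace K z : Set Y) : Set Y) :=
    Submodule.coe_sup _ _
  have hcl : e ∈ closure (P : Set Y) := by
    refine mem_closure_of_forall_inner P fun h hh => ?_
    have hhK : h ∈ K := mem_properCone_of_forall_inner K fun u hu => by
      rw [real_inner_comm]
      exact hh u ((le_sup_left : dualPointedCone (K : Set Y) ≤ P) hu)
    have hperp : ∀ w ∈ perp (minimalFace K z : Set Y), 0 ≤ ⟪w, h⟫ := fun w hw =>
      hh w ((le_sup_right : (perp (minimalFace K z : Set Y)).restrictScalars _ ≤ P) hw)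
    have hhF : h ∈ Submodule.span ℝ (minimalFace K z : Set Y) := by
      rw [← Submodule.orthogonal_orthogonal (Submodule.span ℝ (minimalFace K z : Set Y))]
      intro w hw
      have h1 := hperp w hw
      have h2 := hperp (-w) (Submodule.neg_mem _ hw)
      rw [inner_neg_left] at h2
      linarith
    -- Every element of the span of the minimal face lies between `-r • z` and `r • z` in the order
    -- of `K`; hence `K ∩ span F = F`.
    have hb : ∃ r : ℝ, 0 ≤ r ∧ r • z - h ∈ K ∧ r • z + h ∈ K := by
      clear hh hhK hperp
      induction hhF using Submodule.span_induction with
      | mem x hx =>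
        obtain ⟨hx, r, hr, h⟩ := hx
        exact ⟨r, hr, h, K.toPointedCone.add_mem (K.smul_mem hz hr) hx⟩
      | zero => exact ⟨0, le_rfl, by simp, by simp⟩
      | add x y _ _ hx hy =>
        obtain ⟨r, hr, h1, h2⟩ := hx
        obtain ⟨t, ht, h3, h4⟩ := hy
        refine ⟨r + t, by positivity, ?_, ?_⟩
        · rw [show (r + t) • z - (x + y) = r • z - x + (t • z - y) by module]
          exact K.toPointedCone.add_mem h1 h3
        · rw [show (r + t) • z + (x + y) = r • z + x + (t • z + y) by module]
          exact K.toPointedCone.add_mem h2 h4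
      | smul c x _ hx =>
        obtain ⟨r, hr, h1, h2⟩ := hx
        rcases le_total 0 c with hc | hc
        · refine ⟨c * r, by positivity, ?_, ?_⟩
          · rw [show (c * r) • z - c • x = c • (r • z - x) by module]
            exact K.smul_mem h1 hc
          · rw [show (c * r) • z + c • x = c • (r • z + x) by module]
            exact K.smul_mem h2 hc
        · have hc' : 0 ≤ -c := by linarith
          refine ⟨-c * r, by positivity, ?_, ?_⟩
          · rw [show (-c * r) • z - c • x = (-c) • (r • z + x) by module]
            exact K.smul_mem h2 hc'
          · rw [show (-c * r) • z + c • x = (-c) • (r • z - x) by module]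
            exact K.smul_mem h1 hc'
    obtain ⟨r, hr, h1, -⟩ := hb
    rw [real_inner_comm]
    exact he h ⟨hhK, r, hr, h1⟩
  have hclosed : IsClosed (P : Set Y) := hP ▸ hK _ (minimalFace_isFaceOf z)
  rw [hclosed.closure_eq, hP] at hcl
  obtain ⟨k, hk, w, hw, rfl⟩ := hcl
  exact ⟨k, hk, w, hw, rfl⟩

theorem isClosed_adjoint_image_dualCone_of_isNice (hK : IsNice K) {a : V} (haK : M a ∈ K)
    (ha : ∀ p, M p ∈ K → ∃ ε > (0 : ℝ), M a - ε • M p ∈ K)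
    (hfr : ∀ p, M p ∈ closure (dir (M a) (K : Set Y)) → M p ∈ dir (M a) (K : Set Y)) :
    IsClosed (LinearMap.adjoint M '' dualCone (K : Set Y)) := by
  refine isClosed_adjoint_image_dualCone_iff.2 fun g hg => ?_
  have hzF := mem_intrinsicInterior_minimalFace haK
  have hgE : g ∈ LinearMap.adjoint M '' dualCone (minimalFace K (M a) : Set Y) := by
    rw [← (isClosed_adjoint_image_of_mem_intrinsicInterior _ hzF).closure_eq]
    refine mem_closure_adjoint_image (dualPointedCone (minimalFace K (M a) : Set Y))
      fun p hp => hg p (mem_properCone_of_forall_inner K fun u hu => hp u fun w hw => hu w hw.1)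
  obtain ⟨e, he, rfl⟩ := hgE
  obtain ⟨k, hk, w, hw, rfl⟩ := exists_add_of_mem_dualCone_minimalFace hK haK he
  -- This image is a subspace, hence closed, so bipolarity applies. The test vectors `p` move `M a`
  -- within the minimal face, where `w` vanishes.
  have hw' : LinearMap.adjoint M w ∈ (exposedDualFace K (M a)).map (LinearMap.adjoint M) := by
    have hcl := isClosed_of_neg_mem (neg_mem_map_adjoint_exposedDualFace haK ha hfr)
    rw [← SetLike.mem_coe, ← hcl.closure_eq]
    refine mem_closure_adjoint_image (exposedDualFace K (M a)) fun p hp => ?_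
    obtain ⟨ε, hε, h⟩ := exists_add_smul_mem_minimalFace haK ha hfr hp
    have h1 := mem_perp_iff.1 hw _ h
    have h2 := mem_perp_iff.1 hw _ (intrinsicInterior_subset hzF)
    rw [inner_add_left, real_inner_smul_left, h2, zero_add] at h1
    rw [LinearMap.adjoint_inner_right, (mul_eq_zero.1 h1).resolve_left hε.ne']
  obtain ⟨y, hy, hyw⟩ := hw'
  have hyw' : LinearMap.adjoint M y = LinearMap.adjoint M w := hyw
  refine ⟨k + y, (dualPointedCone (K : Set Y)).add_mem hk hy.1, ?_⟩
  rw [map_add, map_add, hyw']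

end LinearImage

/-! ### Homogenisation of the conic system and the equivalences. -/

section System

variable {X Y : Type*} [NormedAddCommGroup X] [InnerProductSpace ℝ X]
  [NormedAddCommGroup Y] [InnerProductSpace ℝ Y] {K : ProperCone ℝ Y} {A : X →ₗ[ℝ] Y} {b : Y}

theorem opAb_apply (p : WithLp 2 (X × ℝ)) : opAb A b p = A p.fst + p.snd • b := rfl

theorem opAb_toLp (x : X) (t : ℝ) : opAb A b (WithLp.toLp 2 (x, t)) = A x + t • b := rfl

theorem opAb_neg_one (x : X) : opAb A b (WithLp.toLp 2 (-x, 1)) = b - A x := by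
  rw [opAb_toLp, map_neg, one_smul]
  abel

theorem inner_toLp_right (p : WithLp 2 (X × ℝ)) (c : X) (s : ℝ) :
    ⟪p, WithLp.toLp 2 (c, s)⟫ = ⟪p.fst, c⟫ + p.snd * s := by
  rw [WithLp.prod_inner_apply, real_inner_eq_re_inner, RCLike.inner_apply]
  simp [mul_comm]

theorem exists_slack_of_snd_pos {p : WithLp 2 (X × ℝ)} (hp : opAb A b p ∈ K) (ht : 0 < p.snd) :
    p.snd⁻¹ • opAb A b p = b - A (-(p.snd⁻¹ • p.fst)) ∧
      -(p.snd⁻¹ • p.fst) ∈ feasibleSet K A b := by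
  have h : p.snd⁻¹ • opAb A b p = b - A (-(p.snd⁻¹ • p.fst)) := by
    rw [opAb_apply, smul_add, smul_smul, inv_mul_cancel₀ ht.ne', one_smul, map_neg, map_smul]
    abel
  refine ⟨h, ?_⟩
  rw [feasibleSet, Set.mem_ofPred_eq, ← h]
  exact K.smul_mem hp (inv_nonneg.2 ht.le)

/-- Maximality among slacks extends to all of `K ∩ range (A, b)`. For `t > 0` the point rescales to
a slack; for `t = 0` it can be added to `z`; for `t < 0`, adding `-t • z` reduces to `t = 0`. -/
theorem exists_sub_smul_mem_of_isMaximumSlack {z : Y} (hz : IsMaximumSlack K A b z) :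
    ∀ p, opAb A b p ∈ K → ∃ ε > (0 : ℝ), z - ε • opAb A b p ∈ K := by
  obtain ⟨⟨x₀, hx₀⟩, hzK⟩ := intrinsicInterior_subset hz
  have hzero : ∀ x, A x ∈ K → ∃ ε > (0 : ℝ), z - ε • A x ∈ K := by
    intro x hx
    obtain ⟨ε, hε, h⟩ := exists_add_smul_sub_mem hz (w := z + A x)
      ⟨⟨x₀ - x, by rw [hx₀, map_sub]; abel⟩, K.toPointedCone.add_mem hzK hx⟩
    refine ⟨ε, hε, ?_⟩
    convert h.2 using 2
    module
  intro p hp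
  rcases lt_trichotomy p.snd 0 with ht | ht | ht
  · have heq : opAb A b p + (-p.snd) • z = A (p.fst + p.snd • x₀) := by
      rw [opAb_apply, hx₀, map_add, map_smul]
      module
    obtain ⟨ε, hε, h⟩ := hzero (p.fst + p.snd • x₀) (by
      rw [← heq]
      exact K.toPointedCone.add_mem hp (K.smul_mem hzK (by linarith)))
    refine ⟨ε, hε, ?_⟩
    rw [← heq] at h
    have h2 := K.toPointedCone.add_mem h (K.smul_mem hzK (r := ε * -p.snd)
      (mul_nonneg hε.le (by linarith)))
    rw [show z - ε • opAb A b p =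
      z - ε • (opAb A b p + (-p.snd) • z) + (ε * -p.snd) • z by module]
    exact h2
  · have heq : opAb A b p = A p.fst := by rw [opAb_apply, ht, zero_smul, add_zero]
    rw [heq] at hp ⊢
    exact hzero _ hp
  · obtain ⟨h1, h2⟩ := exists_slack_of_snd_pos hp ht
    obtain ⟨ε, hε, h⟩ := exists_add_smul_sub_mem hz (w := p.snd⁻¹ • opAb A b p)
      ⟨⟨_, h1⟩, K.smul_mem hp (inv_nonneg.2 ht.le)⟩
    refine ⟨ε / (1 + ε) * p.snd⁻¹, by positivity, ?_⟩
    convert K.smul_mem h.2 (r := (1 + ε)⁻¹) (by positivity) using 1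
    match_scalars
    · field_simp
    · field_simp

/-- The product of a proper cone with the nonnegative half-line. -/
def prodNonneg (K : ProperCone ℝ Y) : ProperCone ℝ (WithLp 2 (Y × ℝ)) where
  carrier := {p | p.fst ∈ K ∧ 0 ≤ p.snd}
  zero_mem' := ⟨K.toPointedCone.zero_mem, le_rfl⟩
  add_mem' hp hq := ⟨K.toPointedCone.add_mem hp.1 hq.1, add_nonneg hp.2 hq.2⟩
  smul_mem' r _ hp := ⟨K.smul_mem hp.1 r.2, mul_nonneg r.2 hp.2⟩
  isClosed' := by
    have h1 : Continuous fun p : WithLp 2 (Y × ℝ) => p.fst := by fun_prop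
    have h2 : Continuous fun p : WithLp 2 (Y × ℝ) => p.snd := by fun_prop
    exact (K.isClosed.preimage h1).inter (isClosed_le continuous_const h2)

theorem dualCone_prodNonneg (K : ProperCone ℝ Y) :
    dualCone (prodNonneg K : Set (WithLp 2 (Y × ℝ))) =
      {p : WithLp 2 (Y × ℝ) | p.fst ∈ dualCone (K : Set Y) ∧ 0 ≤ p.snd} := by
  ext p
  constructor
  · refine fun h => ⟨fun x hx => ?_, ?_⟩
    · have := h (WithLp.toLp 2 (x, 0)) ⟨hx, le_rfl⟩
      simpa [WithLp.prod_inner_apply] using this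
    · have := h (WithLp.toLp 2 (0, 1)) ⟨K.toPointedCone.zero_mem, zero_le_one⟩
      simpa [WithLp.prod_inner_apply] using this
  · rintro ⟨h1, h2⟩ q ⟨hq1, hq2⟩
    rw [WithLp.prod_inner_apply]
    exact add_nonneg (h1 _ hq1) (mul_nonneg h2 hq2)

theorem noFrontierDirection_iff {z : Y} :
    NoFrontierDirection K A b z ↔ ∀ p, opAb A b p ∈ closure (dir z (K : Set Y)) →
      opAb A b p ∈ dir z (K : Set Y) := by
  rw [NoFrontierDirection, Set.eq_empty_iff_forall_notMem]
  constructor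
  · intro h p hp
    by_contra hnot
    exact h _ ⟨⟨p, rfl⟩, hp, hnot⟩
  · rintro h _ ⟨⟨p, rfl⟩, hp, hnot⟩
    exact hnot (h p hp)

variable [FiniteDimensional ℝ Y]

theorem mem_intrinsicInterior_iff_slaterCondition {z : Y} (hz : IsMaximumSlack K A b z) :
    z ∈ intrinsicInterior ℝ (K : Set Y) ↔ SlaterCondition K A b := by
  obtain ⟨⟨x₀, hx₀⟩, hzK⟩ := intrinsicInterior_subset hz
  refine ⟨fun h => ⟨x₀, hx₀ ▸ h⟩, ?_⟩
  rintro ⟨x, hx⟩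
  obtain ⟨hxK, hint⟩ := mem_intrinsicInterior_pointedCone_iff (C := K.toPointedCone).1 hx
  obtain ⟨ε, hε, h⟩ := exists_sub_smul_mem_of_isMaximumSlack hz (WithLp.toLp 2 (-x, 1)) (by
    rw [opAb_neg_one]; exact hxK)
  rw [opAb_neg_one] at h
  refine mem_intrinsicInterior_pointedCone_iff (C := K.toPointedCone).2 ⟨hzK, fun w hw => ?_⟩
  obtain ⟨η, hη, h'⟩ := hint w hw
  refine ⟨ε * η, by positivity, ?_⟩
  rw [show z - (ε * η) • w = z - ε • (b - A x) + ε • (b - A x - η • w) by module]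
  exact K.toPointedCone.add_mem h (K.smul_mem h' hε.le)

variable [FiniteDimensional ℝ X]

/-- The bipolar criterion for the cone `K × ℝ₊`; `s` is the multiplier of the constraint `t ≥ 0`. -/
theorem closedImageExtended_iff :
    ClosedImageExtended K A b ↔ ∀ g : WithLp 2 (X × ℝ),
      (∀ p, opAb A b p ∈ K → 0 ≤ p.snd → 0 ≤ ⟪p, g⟫) →
        ∃ y ∈ dualCone (K : Set Y), ∃ s : ℝ, 0 ≤ s ∧
          ∀ p : WithLp 2 (X × ℝ), ⟪p, g⟫ = ⟪opAb A b p, y⟫ + p.snd * s := by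
  have hinner : ∀ (p : WithLp 2 (X × ℝ)) (y : Y) (s : ℝ),
      ⟪opAb01 A b p, WithLp.toLp 2 (y, s)⟫ = ⟪opAb A b p, y⟫ + p.snd * s := fun p y s => by
    rw [inner_toLp_right]
    rfl
  rw [ClosedImageExtended, ← dualCone_prodNonneg, isClosed_adjoint_image_dualCone_iff]
  refine forall_congr' fun g => imp_congr ?_ ?_
  · exact ⟨fun h p hp ht => h p ⟨hp, ht⟩, fun h p hp => h p hp.1 hp.2⟩
  · rw [dualCone_prodNonneg]
    constructor
    · rintro ⟨q, ⟨hq1, hq2⟩, rfl⟩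
      refine ⟨q.fst, hq1, q.snd, hq2, fun p => ?_⟩
      rw [LinearMap.adjoint_inner_right, ← hinner]
      rfl
    · rintro ⟨y, hy, s, hs, h⟩
      refine ⟨WithLp.toLp 2 (y, s), ⟨hy, hs⟩, ?_⟩
      refine ext_inner_left ℝ fun p => ?_
      rw [LinearMap.adjoint_inner_right, hinner, h]

/-- The multiplier `s` must make `g - (0, s)` nonnegative on all of `M⁻¹ K`. Points with `t > 0`
bound `s` above by `⟪p, g⟫ / t`, and the infimum of these ratios is chosen. Points with `t < 0` give
lower bounds, compatible because a positive combination of the two kinds has `t = 0`. -/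
theorem ClosedImage.closedImageExtended {x₀ : X} (hx₀ : x₀ ∈ feasibleSet K A b)
    (h : ClosedImage K A b) : ClosedImageExtended K A b := by
  refine closedImageExtended_iff.2 fun g hg => ?_
  have hmem := isClosed_adjoint_image_dualCone_iff.1 h
  let T : Set ℝ := {r | ∃ p, opAb A b p ∈ K ∧ 0 < p.snd ∧ r = ⟪p, g⟫ / p.snd}
  have hT0 : ∀ r ∈ T, 0 ≤ r := by
    rintro _ ⟨p, hp, ht, rfl⟩
    exact div_nonneg (hg p hp ht.le) ht.le
  have hTne : T.Nonempty :=
    ⟨_, WithLp.toLp 2 (-x₀, 1), by rw [opAb_neg_one]; exact hx₀, one_pos, rfl⟩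
  have hbdd : BddBelow T := ⟨0, hT0⟩
  obtain ⟨y, hy, hyg⟩ := hmem (g - WithLp.toLp 2 (0, sInf T)) fun q hq => by
    rw [inner_sub_right, inner_toLp_right q 0, inner_zero_right, zero_add, sub_nonneg]
    rcases lt_trichotomy q.snd 0 with ht | ht | ht
    · have : ⟪q, g⟫ / q.snd ≤ sInf T := by
        refine le_csInf hTne ?_
        rintro _ ⟨p, hp, hpt, rfl⟩
        have h1 : opAb A b (p.snd • q + (-q.snd) • p) ∈ K := by
          rw [map_add, map_smul, map_smul]
          exact K.toPointedCone.add_mem (K.smul_mem hq hpt.le) (K.smul_mem hp (by linarith))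
        have h2 := hg _ h1 (by
          change 0 ≤ p.snd * q.snd + -q.snd * p.snd
          linarith)
        rw [inner_add_left, real_inner_smul_left, real_inner_smul_left] at h2
        rw [div_le_iff_of_neg ht, div_mul_eq_mul_div, div_le_iff₀ hpt]
        linarith
      rw [div_le_iff_of_neg ht] at this
      linarith
    · rw [ht, zero_mul]
      exact hg q hq ht.ge
    · have := csInf_le hbdd ⟨q, hq, ht, rfl⟩
      rw [le_div_iff₀ ht] at this
      linarith
  refine ⟨y, hy, sInf T, le_csInf hTne hT0, fun p => ?_⟩
  rw [← LinearMap.adjoint_inner_right, hyg, inner_sub_right, inner_toLp_right p 0, inner_zero_right]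
  ring

/-- The vector `(c, v)` is nonnegative on the homogenised cone, by rescaling where `t > 0` and by
recession where `t = 0`. The resulting `y` satisfies `v = ⟪b, y⟫ + s`, and weak duality forces `s =
0`. -/
theorem ClosedImageExtended.wellBehaved (h : ClosedImageExtended K A b) :
    WellBehaved K A b := by
  intro c v hv
  obtain ⟨x₀, hx₀⟩ := hv.nonempty.of_image
  have hle : ∀ x ∈ feasibleSet K A b, ⟪c, x⟫ ≤ v := fun x hx => hv.1 ⟨x, hx, rfl⟩
  obtain ⟨y, hy, s, hs, hys⟩ := closedImageExtended_iff.1 h (WithLp.toLp 2 (c, v))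
    fun p hp ht => by
      rw [inner_toLp_right]
      rcases ht.eq_or_lt with ht | ht
      · rw [← ht, zero_mul, add_zero]
        have hA : A p.fst ∈ K := by
          rwa [opAb_apply, ← ht, zero_smul, add_zero] at hp
        by_contra hlt
        push Not at hlt
        obtain ⟨n, hn⟩ := exists_nat_gt ((v - ⟪c, x₀⟫) / -⟪p.fst, c⟫)
        have := hle (x₀ - (n : ℝ) • p.fst) (by
          change b - A _ ∈ K
          rw [map_sub, map_smul, show b - (A x₀ - (n : ℝ) • A p.fst) =
            b - A x₀ + (n : ℝ) • A p.fst by abel]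
          exact K.toPointedCone.add_mem hx₀ (K.smul_mem hA n.cast_nonneg))
        rw [inner_sub_right, inner_smul_right, real_inner_comm p.fst c] at this
        rw [div_lt_iff₀ (by linarith)] at hn
        linarith
      · have := hle _ (exists_slack_of_snd_pos hp ht).2
        rw [inner_neg_right, inner_smul_right, real_inner_comm] at this
        have h3 := mul_le_mul_of_nonneg_left this ht.le
        rw [mul_neg, ← mul_assoc, mul_inv_cancel₀ ht.ne', one_mul] at h3
        linarith
  have hAy : LinearMap.adjoint A y = c := by
    refine ext_inner_left ℝ fun x => ?_
    have := hys (WithLp.toLp 2 (x, 0))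
    rw [inner_toLp_right, opAb_toLp] at this
    rw [LinearMap.adjoint_inner_right]
    simpa using this.symm
  have hby : v = ⟪b, y⟫ + s := by
    have := hys (WithLp.toLp 2 (0, 1))
    rw [inner_toLp_right, opAb_toLp] at this
    simpa using this
  refine ⟨y, hy, hAy, le_antisymm (by linarith) (hv.2 ?_)⟩
  rintro _ ⟨x, hx, rfl⟩
  have := hy _ hx
  rw [inner_sub_left, ← LinearMap.adjoint_inner_right, hAy, real_inner_comm c x] at this
  change ⟪c, x⟫ ≤ _
  linarith

/-- A dual optimal `y` for `c = g.fst` serves, and the excess of `g.snd` over the supremum is the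
multiplier `s`. -/
theorem WellBehaved.closedImageExtended {x₀ : X} (hx₀ : x₀ ∈ feasibleSet K A b)
    (h : WellBehaved K A b) : ClosedImageExtended K A b := by
  refine closedImageExtended_iff.2 fun g hg => ?_
  have hle : ∀ x ∈ feasibleSet K A b, ⟪g.fst, x⟫ ≤ g.snd := by
    intro x hx
    have := hg (WithLp.toLp 2 (-x, 1)) (by rw [opAb_neg_one]; exact hx) zero_le_one
    rw [real_inner_comm, show (WithLp.toLp 2 (-x, 1) : WithLp 2 (X × ℝ)) = _ from rfl,
      inner_toLp_right, inner_neg_right] at this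
    linarith
  have hlub := isLUB_csSup (s := (fun x => ⟪g.fst, x⟫) '' feasibleSet K A b)
    ⟨_, x₀, hx₀, rfl⟩ ⟨g.snd, by rintro _ ⟨x, hx, rfl⟩; exact hle x hx⟩
  obtain ⟨y, hy, hAy, hby⟩ := h _ _ hlub
  refine ⟨y, hy, g.snd - ⟪b, y⟫, ?_, fun p => ?_⟩
  · rw [hby, sub_nonneg]
    exact hlub.2 (by rintro _ ⟨x, hx, rfl⟩; exact hle x hx)
  · have : ⟪p, g⟫ = ⟪p.fst, g.fst⟫ + p.snd * g.snd := inner_toLp_right p g.fst g.snd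
    rw [this, opAb_apply, inner_add_left, ← LinearMap.adjoint_inner_right, hAy,
      real_inner_smul_left]
    ring

theorem wellBehaved_of_closedImage (h : ClosedImage K A b) : WellBehaved K A b := by
  intro c v hv
  exact (h.closedImageExtended hv.nonempty.of_image.some_mem).wellBehaved c v hv

theorem ClosedImageExtended.mem_dir {z : Y} (hz : IsMaximumSlack K A b z)
    (h : ClosedImageExtended K A b) (k : WithLp 2 (X × ℝ))
    (hk : opAb A b k ∈ closure (dir z (K : Set Y))) : opAb A b k ∈ dir z (K : Set Y) := by
  obtain ⟨⟨x₀, hx₀⟩, hzK⟩ := intrinsicInterior_subset hz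
  let a : WithLp 2 (X × ℝ) := WithLp.toLp 2 (-x₀, 1)
  have haz : opAb A b a = z := by rw [hx₀]; exact opAb_neg_one x₀
  let D : PointedCone ℝ (WithLp 2 (X × ℝ)) :=
    (prodNonneg K).toPointedCone.comap (opAb01 A b)
  have hD : ∀ p, p ∈ D ↔ opAb A b p ∈ K ∧ 0 ≤ p.snd := fun p => Iff.rfl
  have haD : a ∈ D := (hD a).2 ⟨haz ▸ hzK, zero_le_one⟩
  have hint : ∀ p ∈ D, ∃ ε > (0 : ℝ), a - ε • p ∈ D := by
    intro p hp
    obtain ⟨hp1, hp2⟩ := (hD p).1 hp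
    obtain ⟨ε, hε, hmem⟩ := exists_sub_smul_mem_of_isMaximumSlack hz p hp1
    -- Dividing `ε` by `1 + ε * p.snd` keeps the last coordinate of `a - ε • p` nonnegative.
    have hpos : 0 < 1 + ε * p.snd := by positivity
    refine ⟨ε / (1 + ε * p.snd), by positivity, (hD _).2 ⟨?_, ?_⟩⟩
    · rw [map_sub, map_smul, haz]
      have heq : z - (ε / (1 + ε * p.snd)) • opAb A b p =
          (1 + ε * p.snd)⁻¹ • (z - ε • opAb A b p) + (ε * p.snd / (1 + ε * p.snd)) • z := by
        match_scalars
        · field_simp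
        · field_simp
      rw [heq]
      exact K.toPointedCone.add_mem (K.smul_mem hmem (inv_nonneg.2 hpos.le))
        (K.smul_mem hzK (by positivity))
    · change 0 ≤ 1 - ε / (1 + ε * p.snd) * p.snd
      rw [sub_nonneg, div_mul_eq_mul_div, div_le_one hpos]
      linarith
  obtain ⟨ε, hε, hmem⟩ := exists_add_smul_mem (k := k) hint (fun g hg hag => by
    obtain ⟨y, hy, s, hs, hys⟩ := closedImageExtended_iff.1 h g fun p hp ht =>
      hg p ((hD p).2 ⟨hp, ht⟩)
    -- Vanishing at `a` reads `⟪z, y⟫ + s = 0` with both terms nonnegative, so `y` lies in the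
    -- exposed dual face and `s = 0`.
    have ha := hys a
    have has : a.snd = 1 := rfl
    rw [hag, haz, has, one_mul] at ha
    have hzy := hy z hzK
    have hs0 : s = 0 := by linarith
    rw [hys, hs0, mul_zero, add_zero]
    exact (mem_closure_dir_iff hzK).1 hk y hy (by linarith)) haD
  refine ⟨ε, hε, ?_⟩
  have := ((hD _).1 hmem).1
  rwa [map_add, map_smul, haz] at this

theorem wellBehaved_of_slaterCondition (h : SlaterCondition K A b) : WellBehaved K A b := by
  obtain ⟨x, hx⟩ := h
  refine wellBehaved_of_closedImage
    (isClosed_adjoint_image_of_mem_intrinsicInterior (M := opAb A b) K.toPointedCone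
      (a := WithLp.toLp 2 (-x, 1)) ?_)
  rw [opAb_neg_one]
  exact hx

theorem tfae_of_isNice (hK : IsNice K) {z : Y} (hz : IsMaximumSlack K A b z) :
    List.TFAE [WellBehaved K A b, ClosedImageExtended K A b, ClosedImage K A b,
      NoFrontierDirection K A b z, ComplementaryAndTangent K A b z] := by
  obtain ⟨⟨x₀, hx₀⟩, hzK⟩ := intrinsicInterior_subset hz
  have hfeas : x₀ ∈ feasibleSet K A b := by
    rw [feasibleSet, Set.mem_ofPred_eq, ← hx₀]
    exact hzK
  have haz : opAb A b (WithLp.toLp 2 (-x₀, 1)) = z := by rw [hx₀]; exact opAb_neg_one x₀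
  have hint := exists_sub_smul_mem_of_isMaximumSlack hz
  tfae_have 1 → 2 := fun h => h.closedImageExtended hfeas
  tfae_have 2 → 1 := fun h => h.wellBehaved
  tfae_have 3 → 2 := fun h => h.closedImageExtended hfeas
  tfae_have 2 → 4 := fun h => noFrontierDirection_iff.2 (h.mem_dir hz)
  tfae_have 4 → 5 := fun h => by
    have hfr := noFrontierDirection_iff.1 h
    refine ⟨?_, range_inter_tanSpace_sdiff_ldir_eq_empty hfr⟩
    rw [← haz] at hzK hint hfr ⊢
    exact exists_strictlyComplementary hzK hint hfr
  tfae_have 5 → 4 := by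
    rintro ⟨⟨u, hker, -, hsc⟩, htan⟩
    exact noFrontierDirection_iff.2 fun p hp =>
      mem_dir_of_strictlyComplementary hzK hker hsc htan hp
  tfae_have 4 → 3 := fun h => by
    have hfr := noFrontierDirection_iff.1 h
    rw [← haz] at hzK hint hfr
    exact isClosed_adjoint_image_dualCone_of_isNice hK hzK hint hfr
  tfae_finish

end System

end ConicSystem

theorem corollary2p1 {X Y : Type*}
    [NormedAddCommGroup X] [InnerProductSpace ℝ X] [FiniteDimensional ℝ X]
    [NormedAddCommGroup Y] [InnerProductSpace ℝ Y] [FiniteDimensional ℝ Y]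
    (K : ProperCone ℝ Y) (A : X →ₗ[ℝ] Y) (b : Y) :
    (ConicSystem.IsPolyhedral K → ConicSystem.WellBehaved K A b) ∧
    (∀ z : Y, ConicSystem.IsMaximumSlack K A b z →
      (z ∈ intrinsicInterior ℝ (K : Set Y) ↔ ConicSystem.SlaterCondition K A b) ∧
      (z ∈ intrinsicInterior ℝ (K : Set Y) → ConicSystem.WellBehaved K A b)) ∧
    (ConicSystem.IsNice K → ∀ z : Y, ConicSystem.IsMaximumSlack K A b z →
      List.TFAE [
        ConicSystem.WellBehaved K A b,
        ConicSystem.ClosedImageExtended K A b,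
        ConicSystem.ClosedImage K A b,
        ConicSystem.NoFrontierDirection K A b z,
        ConicSystem.ComplementaryAndTangent K A b z]) := by
  refine ⟨fun hK => ConicSystem.wellBehaved_of_closedImage
    (ConicSystem.isClosed_adjoint_image_dualCone_of_isPolyhedral hK), fun z hz => ?_,
    fun hK z hz => ConicSystem.tfae_of_isNice hK hz⟩
  have hiff := ConicSystem.mem_intrinsicInterior_iff_slaterCondition hz
  exact ⟨hiff, fun h => ConicSystem.wellBehaved_of_slaterCondition (hiff.1 h)⟩
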